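/- A differential space is a topological space $S$ with a family $C^\infty(S)$ of real-valued functions such that (1) the sets $f^{-1}(I)$, with $f\in C^\infty(S)$ and $I\subseteq\mathbb{R}$ an open interval, form a subbasis of the topology; (2) $F(f_1,\dots,f_n)\in C^\infty(S)$ for all $f_1,\dots,f_n\in C^\infty(S)$ and all smooth $F:\mathbb{R}^n\to\mathbb{R}$; (3) a function that coincides near each point with an element of $C^\infty(S)$ belongs to $C^\infty(S)$. A map $\varphi$ of differential spaces is smooth if $f\circ\varphi$ is smooth for every smooth $f$ on the target, and a diffeomorphism if it is also invertible with smooth inverse. Subsets and products of differential spaces carry the structures generated by the restrictions, respectively the pullbacks, of smooth functions. The space $S$ is subcartesian if it is Hausdorff and every point has an open neighbourhood diffeomorphic to a subset of some $\mathbb{R}^n$; the smallest such $n$ is the structural dimension of $S$ at that point, and the structural dimension of $S$ is the supremum of these numbers over the points of $S$. A smooth vector bundle $(E,\pi,S,\mathbb{R}^k)$ is a smooth map $\pi:E\to S$ of subcartesian spaces with a real vector space structure on each fibre $\pi^{-1}(x)$, such that $S$ is covered by open sets $U$ for which there are diffeomorphisms $\psi:U\times\mathbb{R}^k\to\pi^{-1}(U)$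 with $\pi(\psi(x,y))=x$ whose inverse restricts to a linear isomorphism $\pi^{-1}(x)\to\{x\}\times\mathbb{R}^k$ for each $x\in U$. **Proposition.** Let $S$ be a connected, second countable subcartesian space of finite structural dimension, and let $(E,\pi,S,\mathbb{R}^k)$ be a smooth vector bundle. Then there exist $l\in\mathbb{N}$ and an injective smooth bundle map $\varphi:E\to S\times\mathbb{R}^l$ into the trivial bundle over $S$, that is, an injective smooth map which sends each fibre $\pi^{-1}(x)$ linearly into $\{x\}\times\mathbb{R}^l$. -/

import Mathlib

open Set Topology
open scoped ContDiff

/-! # Differential spaces (in the sense of Sikorski) -/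

/-- A differential structure on a topological space `S`: a family of real-valued functions,
called smooth, such that the preimages of open intervals form a subbasis of the topology,
which is stable under composition with smooth functions of several variables, and which is
local. -/
class DifferentialSpace (S : Type*) [t : TopologicalSpace S] where
  /-- The family `C^∞(S)`. -/
  smooth : Set (S → ℝ)
  subbasis : t = TopologicalSpace.generateFrom
    {W | ∃ f ∈ smooth, ∃ a b : ℝ, W = f ⁻¹' Ioo a b}
  comp_mem : ∀ (n : ℕ) (f : Fin n → S → ℝ), (∀ i, f i ∈ smooth) →
    ∀ F : (Fin n → ℝ) → ℝ, ContDiff ℝ ∞ F → (fun x => F (fun i => f i x)) ∈ smooth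
  local_mem : ∀ f : S → ℝ,
    (∀ x, ∃ U : Set S, IsOpen U ∧ x ∈ U ∧ ∃ g ∈ smooth, ∀ y ∈ U, g y = f y) → f ∈ smooth

namespace DifferentialSpace

theorem continuous_of_mem {S : Type*} [TopologicalSpace S] [DifferentialSpace S]
    {f : S → ℝ} (hf : f ∈ smooth (S := S)) : Continuous f := by
  rw [Real.isTopologicalBasis_Ioo_rat.continuous_iff]
  intro s hs
  simp only [mem_iUnion, mem_singleton_iff] at hs
  obtain ⟨a, b, _, rfl⟩ := hs
  have h := DifferentialSpace.subbasis (S := S)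
  rw [h]
  exact TopologicalSpace.isOpen_generateFrom_of_mem ⟨f, hf, a, b, rfl⟩

/-- The functions that are locally of the form `G(g₁, …, gₙ)` with `gᵢ` in the family `F`
and `G ∈ C^∞(ℝⁿ)`. -/
def generated {X : Type*} [TopologicalSpace X] (F : Set (X → ℝ)) : Set (X → ℝ) :=
  {f | ∀ x, ∃ U : Set X, IsOpen U ∧ x ∈ U ∧ ∃ (n : ℕ) (g : Fin n → X → ℝ),
    (∀ i, g i ∈ F) ∧ ∃ G : (Fin n → ℝ) → ℝ, ContDiff ℝ ∞ G ∧
      ∀ y ∈ U, f y = G (fun i => g i y)}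

theorem subset_generated {X : Type*} [TopologicalSpace X] (F : Set (X → ℝ)) :
    F ⊆ generated F := fun f hf _ =>
  ⟨univ, isOpen_univ, mem_univ _, 1, fun _ => f, fun _ => hf, fun v => v 0,
    contDiff_apply ℝ ℝ (0 : Fin 1), fun _ _ => rfl⟩

theorem continuous_of_mem_generated {X : Type*} [TopologicalSpace X] {F : Set (X → ℝ)}
    (hF : ∀ f ∈ F, Continuous f) {f : X → ℝ} (hf : f ∈ generated F) : Continuous f := by
  rw [continuous_iff_continuousAt]
  intro x
  obtain ⟨U, hU, hx, n, g, hg, G, hG, h⟩ := hf x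
  have hc : Continuous fun y => G (fun i => g i y) :=
    hG.continuous.comp (continuous_pi fun i => hF _ (hg i))
  refine hc.continuousAt.congr ?_
  filter_upwards [hU.mem_nhds hx] with y hy
  exact (h y hy).symm

/-- The differential structure generated by a family `F` of functions which defines the
topology. -/
abbrev ofGenerators {X : Type*} [t : TopologicalSpace X] (F : Set (X → ℝ))
    (h : t = TopologicalSpace.generateFrom {W | ∃ f ∈ F, ∃ a b : ℝ, W = f ⁻¹' Ioo a b}) :
    DifferentialSpace X where
  smooth := generated F
  subbasis := by
    have hF : ∀ f ∈ F, Continuous f := by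
      intro f hf
      rw [Real.isTopologicalBasis_Ioo_rat.continuous_iff]
      intro s hs
      simp only [mem_iUnion, mem_singleton_iff] at hs
      obtain ⟨a, b, _, rfl⟩ := hs
      rw [h]
      exact TopologicalSpace.isOpen_generateFrom_of_mem ⟨f, hf, a, b, rfl⟩
    apply le_antisymm
    · apply le_generateFrom
      rintro _ ⟨f, hf, a, b, rfl⟩
      exact isOpen_Ioo.preimage (continuous_of_mem_generated hF hf)
    · conv_rhs => rw [h]
      apply TopologicalSpace.generateFrom_anti
      rintro _ ⟨f, hf, a, b, rfl⟩
      exact ⟨f, subset_generated F hf, a, b, rfl⟩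
  comp_mem := by
    intro n f hf K hK x
    choose U hU hx m g hg G hG hfg using fun i => hf i x
    refine ⟨⋂ i, U i, isOpen_iInter_of_finite hU, mem_iInter.2 hx, ∑ i, m i,
      fun j => g (finSigmaFinEquiv.symm j).1 (finSigmaFinEquiv.symm j).2, fun j => hg _ _,
      fun v => K (fun i => G i (fun j => v (finSigmaFinEquiv ⟨i, j⟩))), ?_, ?_⟩
    · refine hK.comp (contDiff_pi.2 fun i => (hG i).comp (contDiff_pi.2 fun j => ?_))
      exact contDiff_apply ℝ ℝ _
    · intro y hy
      refine congrArg K (funext fun i => ?_)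
      rw [hfg i y (mem_iInter.1 hy i)]
      refine congrArg (G i) (funext fun j => ?_)
      beta_reduce
      rw [Equiv.symm_apply_apply]
  local_mem := by
    intro f hf x
    obtain ⟨U, hU, hx, g, hg, hgf⟩ := hf x
    obtain ⟨V, hV, hxV, n, q, hq, G, hG, h⟩ := hg x
    exact ⟨U ∩ V, hU.inter hV, ⟨hx, hxV⟩, n, q, hq, G, hG,
      fun y hy => by rw [← hgf y hy.1, h y hy.2]⟩

/-- Euclidean space, with its usual smooth functions. -/
instance euclidean (n : ℕ) : DifferentialSpace (EuclideanSpace ℝ (Fin n)) where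
  smooth := {f | ContDiff ℝ ∞ f}
  subbasis := by
    apply le_antisymm
    · apply le_generateFrom
      rintro _ ⟨f, hf, a, b, rfl⟩
      have hf' : ContDiff ℝ ∞ f := hf
      exact isOpen_Ioo.preimage hf'.continuous
    · intro O hO
      refine (@isOpen_iff_forall_mem_open _ (TopologicalSpace.generateFrom _) O).2 fun x hx => ?_
      obtain ⟨ε, hε, hb⟩ := Metric.isOpen_iff.1 hO x hx
      refine ⟨Metric.ball x ε, hb, ?_, Metric.mem_ball_self hε⟩
      apply TopologicalSpace.isOpen_generateFrom_of_mem
      have hq : ContDiff ℝ ∞ fun y => ‖y - x‖ ^ 2 :=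
        (contDiff_id.sub contDiff_const).norm_sq ℝ
      refine ⟨fun y => ‖y - x‖ ^ 2, hq, -1, ε ^ 2, ?_⟩
      ext y
      simp only [Metric.mem_ball, dist_eq_norm, mem_preimage, mem_Ioo]
      constructor
      · intro h
        exact ⟨by nlinarith [sq_nonneg ‖y - x‖], by gcongr⟩
      · intro h
        exact lt_of_pow_lt_pow_left₀ 2 hε.le h.2
  comp_mem := by
    intro n f hf F hF
    exact ContDiff.comp hF (contDiff_pi.2 hf)
  local_mem := by
    intro f hf
    change ContDiff ℝ ∞ f
    refine contDiff_iff_contDiffAt.2 fun x => ?_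
    obtain ⟨U, hU, hx, g, hg, hgf⟩ := hf x
    have hg' : ContDiff ℝ ∞ g := hg
    refine hg'.contDiffAt.congr_of_eventuallyEq ?_
    filter_upwards [hU.mem_nhds hx] with y hy
    exact (hgf y hy).symm

/-- The restrictions of smooth functions to a subset. -/
def restrictions {S : Type*} [TopologicalSpace S] [DifferentialSpace S] (A : Set S) :
    Set (A → ℝ) :=
  {f | ∃ g ∈ smooth (S := S), f = fun x : A => g x}

theorem restrictions_subbasis {S : Type*} [TopologicalSpace S] [DifferentialSpace S]
    (A : Set S) : (instTopologicalSpaceSubtype : TopologicalSpace A) =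
      TopologicalSpace.generateFrom
        {W | ∃ f ∈ restrictions A, ∃ a b : ℝ, W = f ⁻¹' Ioo a b} := by
  refine (congrArg (TopologicalSpace.induced Subtype.val)
    (DifferentialSpace.subbasis (S := S))).trans ?_
  rw [induced_generateFrom_eq]
  congr 1
  ext W
  constructor
  · rintro ⟨_, ⟨f, hf, a, b, rfl⟩, rfl⟩
    exact ⟨_, ⟨f, hf, rfl⟩, a, b, rfl⟩
  · rintro ⟨_, ⟨f, hf, rfl⟩, a, b, rfl⟩
    exact ⟨_, ⟨f, hf, a, b, rfl⟩, rfl⟩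

/-- A subset of a differential space, with the structure generated by the restrictions of
smooth functions. -/
instance subspace {S : Type*} [TopologicalSpace S] [DifferentialSpace S] (A : Set S) :
    DifferentialSpace A :=
  ofGenerators (restrictions A) (restrictions_subbasis A)

/-- The pullbacks to a product of the smooth functions on the two factors. -/
def pullbacks (S T : Type*) [TopologicalSpace S] [DifferentialSpace S]
    [TopologicalSpace T] [DifferentialSpace T] : Set (S × T → ℝ) :=
  {f | ∃ g ∈ smooth (S := S), f = fun p => g p.1} ∪
    {f | ∃ g ∈ smooth (S := T), f = fun p => g p.2}

theorem pullbacks_subbasis (S T : Type*) [TopologicalSpace S] [DifferentialSpace S]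
    [TopologicalSpace T] [DifferentialSpace T] :
    (instTopologicalSpaceProd : TopologicalSpace (S × T)) =
      TopologicalSpace.generateFrom
        {W | ∃ f ∈ pullbacks S T, ∃ a b : ℝ, W = f ⁻¹' Ioo a b} := by
  refine (congrArg₂ (fun s t => TopologicalSpace.induced Prod.fst s ⊓
    TopologicalSpace.induced Prod.snd t) (DifferentialSpace.subbasis (S := S))
    (DifferentialSpace.subbasis (S := T))).trans ?_
  simp only [induced_generateFrom_eq]
  rw [← generateFrom_union]
  congr 1
  ext W
  constructor
  · rintro (⟨_, ⟨f, hf, a, b, rfl⟩, rfl⟩ | ⟨_, ⟨f, hf, a, b, rfl⟩, rfl⟩)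
    · exact ⟨_, Or.inl ⟨f, hf, rfl⟩, a, b, rfl⟩
    · exact ⟨_, Or.inr ⟨f, hf, rfl⟩, a, b, rfl⟩
  · rintro ⟨_, ⟨f, hf, rfl⟩ | ⟨f, hf, rfl⟩, a, b, rfl⟩
    · exact Or.inl ⟨_, ⟨f, hf, a, b, rfl⟩, rfl⟩
    · exact Or.inr ⟨_, ⟨f, hf, a, b, rfl⟩, rfl⟩

/-- The product of two differential spaces, with the structure generated by the pullbacks of
the smooth functions on the factors. -/
instance product {S T : Type*} [TopologicalSpace S] [DifferentialSpace S]
    [TopologicalSpace T] [DifferentialSpace T] : DifferentialSpace (S × T) :=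
  ofGenerators (pullbacks S T) (pullbacks_subbasis S T)

/-- A map of differential spaces is smooth if it pulls smooth functions back to smooth
functions. -/
def IsSmoothMap {R S : Type*} [TopologicalSpace R] [DifferentialSpace R]
    [TopologicalSpace S] [DifferentialSpace S] (φ : R → S) : Prop :=
  ∀ f ∈ smooth (S := S), f ∘ φ ∈ smooth (S := R)

/-- A diffeomorphism is an invertible smooth map with smooth inverse. -/
def IsDiffeo {R S : Type*} [TopologicalSpace R] [DifferentialSpace R]
    [TopologicalSpace S] [DifferentialSpace S] (e : R ≃ S) : Prop :=
  IsSmoothMap e ∧ IsSmoothMap e.symm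

/-- Smoothness into a space with a generated structure can be tested on generators. -/
theorem comp_mem_of_generated {R X : Type*} [TopologicalSpace R] [DifferentialSpace R]
    [t : TopologicalSpace X] {F : Set (X → ℝ)}
    (h : t = TopologicalSpace.generateFrom {W | ∃ f ∈ F, ∃ a b : ℝ, W = f ⁻¹' Ioo a b})
    {φ : R → X} (hφ : ∀ f ∈ F, f ∘ φ ∈ smooth (S := R)) :
    ∀ f ∈ generated F, f ∘ φ ∈ smooth (S := R) := by
  intro f hf
  have hc : Continuous φ := by
    rw [h, continuous_generateFrom_iff]
    rintro _ ⟨f, hf, a, b, rfl⟩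
    exact isOpen_Ioo.preimage (continuous_of_mem (hφ f hf))
  refine DifferentialSpace.local_mem _ fun x => ?_
  obtain ⟨U, hU, hx, n, g, hg, G, hG, hfg⟩ := hf (φ x)
  exact ⟨φ ⁻¹' U, hU.preimage hc, hx, _,
    DifferentialSpace.comp_mem n (fun i => g i ∘ φ) (fun i => hφ _ (hg i)) G hG,
    fun y hy => (hfg _ hy).symm⟩

theorem isSmoothMap_val {S : Type*} [TopologicalSpace S] [DifferentialSpace S] (A : Set S) :
    IsSmoothMap (Subtype.val : A → S) :=
  fun f hf => subset_generated _ ⟨f, hf, rfl⟩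

theorem isSmoothMap_subtype_mk {R S : Type*} [TopologicalSpace R] [DifferentialSpace R]
    [TopologicalSpace S] [DifferentialSpace S] {A : Set S} {φ : R → A}
    (h : IsSmoothMap fun x => (φ x : S)) : IsSmoothMap φ := by
  refine comp_mem_of_generated (restrictions_subbasis A) ?_
  rintro _ ⟨g, hg, rfl⟩
  exact h g hg

theorem isSmoothMap_fst (S T : Type*) [TopologicalSpace S] [DifferentialSpace S]
    [TopologicalSpace T] [DifferentialSpace T] : IsSmoothMap (Prod.fst : S × T → S) :=
  fun f hf => subset_generated _ (Or.inl ⟨f, hf, rfl⟩)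

theorem isSmoothMap_snd (S T : Type*) [TopologicalSpace S] [DifferentialSpace S]
    [TopologicalSpace T] [DifferentialSpace T] : IsSmoothMap (Prod.snd : S × T → T) :=
  fun f hf => subset_generated _ (Or.inr ⟨f, hf, rfl⟩)

theorem isSmoothMap_prod_mk {R S T : Type*} [TopologicalSpace R] [DifferentialSpace R]
    [TopologicalSpace S] [DifferentialSpace S] [TopologicalSpace T] [DifferentialSpace T]
    {φ : R → S × T} (h₁ : IsSmoothMap fun x => (φ x).1)
    (h₂ : IsSmoothMap fun x => (φ x).2) : IsSmoothMap φ := by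
  refine comp_mem_of_generated (pullbacks_subbasis S T) ?_
  rintro _ (⟨g, hg, rfl⟩ | ⟨g, hg, rfl⟩)
  · exact h₁ g hg
  · exact h₂ g hg

theorem IsSmoothMap.comp {R S T : Type*} [TopologicalSpace R] [DifferentialSpace R]
    [TopologicalSpace S] [DifferentialSpace S] [TopologicalSpace T] [DifferentialSpace T]
    {ψ : S → T} {φ : R → S} (hψ : IsSmoothMap ψ) (hφ : IsSmoothMap φ) :
    IsSmoothMap fun x => ψ (φ x) :=
  fun f hf => hφ _ (hψ f hf)

/-- `HasChartAt x n`: some open neighbourhood of `x` is diffeomorphic to a subset of `ℝⁿ`. -/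
def HasChartAt {S : Type*} [TopologicalSpace S] [DifferentialSpace S] (x : S) (n : ℕ) : Prop :=
  ∃ U : Set S, IsOpen U ∧ x ∈ U ∧ ∃ (V : Set (EuclideanSpace ℝ (Fin n))) (φ : U ≃ V),
    IsDiffeo φ

end DifferentialSpace

open DifferentialSpace

/-- A differential space is subcartesian if it is Hausdorff and locally diffeomorphic to subsets
of Euclidean spaces. -/
class SubcartesianSpace (S : Type*) [TopologicalSpace S] [DifferentialSpace S] : Prop
    extends T2Space S where
  exists_chart : ∀ x : S, ∃ n : ℕ, HasChartAt x n

/-- The structural dimension at `x`: the smallest `n` such that a neighbourhood of `x` is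
diffeomorphic to a subset of `ℝⁿ` (`⊤` if there is none). -/
noncomputable def structuralDimAt {S : Type*} [TopologicalSpace S] [DifferentialSpace S]
    (x : S) : ℕ∞ :=
  ⨅ (n : ℕ) (_ : HasChartAt x n), (n : ℕ∞)

/-- The structural dimension of `S`: the smallest upper bound of the structural dimensions at
the points of `S` (`⊤` if they are unbounded). -/
noncomputable def structuralDim (S : Type*) [TopologicalSpace S] [DifferentialSpace S] : ℕ∞ :=
  ⨆ x : S, structuralDimAt x

/-! # Smooth vector bundles -/

/-- A smooth vector bundle `(E, π, S, ℝᵏ)`: a smooth map `π : E → S` with vector space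
structures on the fibres `π⁻¹(x)`, and an open cover of `S` by sets `U` with diffeomorphisms
`ψ : U × ℝᵏ → π⁻¹(U)` over `U` whose inverse restricts, on each fibre `π⁻¹(x)` with `x ∈ U`, to
a linear isomorphism `L` onto `{x} × ℝᵏ`. In particular the fibres are `k`-dimensional. -/
structure SmoothVectorBundle (E S : Type*) [TopologicalSpace E] [DifferentialSpace E]
    [TopologicalSpace S] [DifferentialSpace S] (k : ℕ) where
  /-- The projection `π`. -/
  proj : E → S
  isSmoothMap_proj : IsSmoothMap proj
  /-- The addition on the fibres. -/
  [fibreAddCommGroup : ∀ x : S, AddCommGroup (proj ⁻¹' {x})]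
  /-- The scalar multiplication on the fibres. -/
  [fibreModule : ∀ x : S, Module ℝ (proj ⁻¹' {x})]
  exists_coordinates : ∀ x₀ : S, ∃ U : Set S, IsOpen U ∧ x₀ ∈ U ∧
    ∃ ψ : U × EuclideanSpace ℝ (Fin k) ≃ proj ⁻¹' U, IsDiffeo ψ ∧
      (∀ p, proj (ψ p) = p.1) ∧
      ∀ x : U, ∃ L : (proj ⁻¹' {(x : S)}) ≃ₗ[ℝ] EuclideanSpace ℝ (Fin k),
        ∀ e : proj ⁻¹' {(x : S)}, (ψ (x, L e) : E) = e

namespace SmoothVectorBundle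

/-- The fibre `π⁻¹(x)`. -/
abbrev Fibre {E S : Type*} [TopologicalSpace E] [DifferentialSpace E]
    [TopologicalSpace S] [DifferentialSpace S] {k : ℕ} (B : SmoothVectorBundle E S k) (x : S) :
    Type _ :=
  B.proj ⁻¹' {x}

instance instAddCommGroupFibre {E S : Type*} [TopologicalSpace E] [DifferentialSpace E]
    [TopologicalSpace S] [DifferentialSpace S] {k : ℕ} (B : SmoothVectorBundle E S k) (x : S) :
    AddCommGroup (B.Fibre x) :=
  B.fibreAddCommGroup x

instance instModuleFibre {E S : Type*} [TopologicalSpace E] [DifferentialSpace E]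
    [TopologicalSpace S] [DifferentialSpace S] {k : ℕ} (B : SmoothVectorBundle E S k) (x : S) :
    Module ℝ (B.Fibre x) :=
  B.fibreModule x

/-- A smooth bundle map over the identity of `S`: a smooth map of the total spaces which maps
each fibre linearly into the fibre over the same point. -/
structure IsSmoothBundleMap {E E' S : Type*} [TopologicalSpace E] [DifferentialSpace E]
    [TopologicalSpace E'] [DifferentialSpace E'] [TopologicalSpace S] [DifferentialSpace S]
    {k l : ℕ} (B : SmoothVectorBundle E S k) (B' : SmoothVectorBundle E' S l)
    (φ : E → E') : Prop where
  isSmoothMap : IsSmoothMap φ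
  exists_linear : ∀ x : S, ∃ A : B.Fibre x →ₗ[ℝ] B'.Fibre x,
    ∀ e : B.Fibre x, φ e = (A e : E')

/-- The second projection identifies the fibre of `S × V → S` over `x` with `V`. -/
def fstFibreEquiv {S : Type*} (V : Type*) (x : S) :
    ((Prod.fst : S × V → S) ⁻¹' {x} : Set (S × V)) ≃ V where
  toFun p := p.1.2
  invFun v := ⟨(x, v), rfl⟩
  left_inv := by
    rintro ⟨⟨y, v⟩, rfl⟩
    rfl
  right_inv _ := rfl

/-- The trivial bundle `S × ℝˡ`, whose fibres carry the vector space structure of `ℝˡ`. -/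
noncomputable def trivialBundle (S : Type*) [TopologicalSpace S] [DifferentialSpace S] (l : ℕ) :
    SmoothVectorBundle (S × EuclideanSpace ℝ (Fin l)) S l where
  proj := Prod.fst
  isSmoothMap_proj := isSmoothMap_fst _ _
  fibreAddCommGroup x := (fstFibreEquiv (EuclideanSpace ℝ (Fin l)) x).addCommGroup
  fibreModule x := by
    letI := (fstFibreEquiv (EuclideanSpace ℝ (Fin l)) x).addCommGroup
    exact (fstFibreEquiv (EuclideanSpace ℝ (Fin l)) x).module ℝ
  exists_coordinates x₀ := by
    refine ⟨univ, isOpen_univ, mem_univ _,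
      { toFun := fun p => ⟨(p.1, p.2), mem_univ _⟩
        invFun := fun q => (⟨q.1.1, mem_univ _⟩, q.1.2)
        left_inv := fun _ => rfl
        right_inv := fun _ => rfl }, ⟨?_, ?_⟩, fun _ => rfl, fun x => ?_⟩
    · exact isSmoothMap_subtype_mk (isSmoothMap_prod_mk
        ((isSmoothMap_val _).comp (isSmoothMap_fst _ _)) (isSmoothMap_snd _ _))
    · exact isSmoothMap_prod_mk
        (isSmoothMap_subtype_mk ((isSmoothMap_fst _ _).comp (isSmoothMap_val _)))
        ((isSmoothMap_snd S _).comp (isSmoothMap_val _))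
    · let _ := (fstFibreEquiv (EuclideanSpace ℝ (Fin l)) (x : S)).addCommGroup
      let _ := (fstFibreEquiv (EuclideanSpace ℝ (Fin l)) (x : S)).module ℝ
      refine ⟨(fstFibreEquiv (EuclideanSpace ℝ (Fin l)) (x : S)).linearEquiv ℝ, ?_⟩
      rintro ⟨⟨y, v⟩, hy⟩
      obtain rfl : y = x := hy
      rfl

end SmoothVectorBundle

/-!
Over a set `U` on which `E` is trivial, the coordinates of the fibre, cut off by a smooth function
with support in `U`, are smooth functions `E → ℝ` that are linear on the fibres. Second
countability of `S` yields a sequence `f₀, f₁, …` of such functions that is locally finite over `S`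
and separates the points of each fibre (`exists_fibrewiseLinear_sequence`). For vectors
`c₀, c₁, …` in `ℝˡ` the locally finite sum `Φ = ∑ fᵢ cᵢ` is a smooth map `E → ℝˡ`, linear on the
fibres, and it remains to choose the `cᵢ` such that `Φ` vanishes on no nonzero vector.

The `cᵢ` are chosen one after the other, with `cₙ` outside the range of
`∑_{i < n} fᵢ cᵢ : E → ℝˡ`. If `d` is a nonzero vector of a fibre and `n` is the last index with
`fₙ d ≠ 0`, then `Φ d = 0` would give `cₙ = ∑_{i < n} fᵢ (-d / fₙ d) cᵢ`, which is excluded.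

Such a choice is possible when `l` exceeds the structural dimension of `S` plus `k`. Indeed, near
each point of `E`, finitely many smooth functions are smooth functions of a point of
`ℝᵐ × ℝᵏ`, with `m` the structural dimension at the base point, so the range has Hausdorff
dimension less than `l` (`dimH_range_sum_smul_le`) and its complement is dense.
The argument does not need a finite trivializing cover, so no covering dimension enters.
-/

open Filter

namespace DifferentialSpace

/-! ### Smooth functions and smooth maps -/

section Basic

variable {S : Type*} [TopologicalSpace S] [DifferentialSpace S]

theorem comp_mem_one {f : S → ℝ} (hf : f ∈ smooth (S := S)) {F : ℝ → ℝ} (hF : ContDiff ℝ ∞ F) :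
    (fun x => F (f x)) ∈ smooth (S := S) :=
  DifferentialSpace.comp_mem 1 (fun _ => f) (fun _ => hf) (fun v => F (v 0))
    (hF.comp (contDiff_apply ℝ ℝ (0 : Fin 1)))

theorem const_mem (c : ℝ) : (fun _ => c) ∈ smooth (S := S) :=
  DifferentialSpace.comp_mem 0 (fun _ _ => 0) (fun i => i.elim0) (fun _ => c) contDiff_const

theorem mul_mem {f g : S → ℝ} (hf : f ∈ smooth (S := S)) (hg : g ∈ smooth (S := S)) :
    (fun x => f x * g x) ∈ smooth (S := S) :=
  DifferentialSpace.comp_mem 2 ![f, g] (by simp [Fin.forall_fin_two, hf, hg])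
    (fun v => v 0 * v 1) ((contDiff_apply ℝ ℝ (0 : Fin 2)).mul (contDiff_apply ℝ ℝ (1 : Fin 2)))

theorem prod_range_mem {f : ℕ → S → ℝ} (hf : ∀ i, f i ∈ smooth (S := S)) (n : ℕ) :
    (fun x => ∏ i ∈ Finset.range n, f i x) ∈ smooth (S := S) := by
  induction n with
  | zero => simpa using const_mem (S := S) 1
  | succ n ih =>
    simp only [Finset.prod_range_succ]
    exact mul_mem ih (hf n)

theorem sum_range_mul_mem {f : ℕ → S → ℝ} (hf : ∀ i, f i ∈ smooth (S := S)) (a : ℕ → ℝ) (n : ℕ) :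
    (fun x => ∑ i ∈ Finset.range n, f i x * a i) ∈ smooth (S := S) := by
  have h := DifferentialSpace.comp_mem n (fun i => f i) (fun i => hf i)
    (fun v => ∑ i, v i * a i)
    (ContDiff.sum fun i _ => (contDiff_apply ℝ ℝ i).mul contDiff_const)
  simpa only [Finset.sum_range] using h

theorem mem_of_eventuallyEq {f : S → ℝ} (h : ∀ x, ∃ g ∈ smooth (S := S), f =ᶠ[𝓝 x] g) :
    f ∈ smooth (S := S) := by
  refine DifferentialSpace.local_mem f fun x => ?_
  obtain ⟨g, hg, hfg⟩ := h x
  obtain ⟨U, hU, hUo, hx⟩ := eventually_nhds_iff.1 hfg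
  exact ⟨U, hUo, hx, g, hg, fun y hy => (hU y hy).symm⟩

theorem IsSmoothMap.continuous {R : Type*} [TopologicalSpace R] [DifferentialSpace R]
    {φ : R → S} (hφ : IsSmoothMap φ) : Continuous φ := by
  have h := DifferentialSpace.subbasis (S := S)
  rw [h, continuous_generateFrom_iff]
  rintro _ ⟨f, hf, a, b, rfl⟩
  exact isOpen_Ioo.preimage (continuous_of_mem (hφ f hf))

theorem exists_eventuallyEq_of_mem_subspace {A : Set S} {f : A → ℝ} (hf : f ∈ smooth (S := A))
    (x : A) : ∃ g ∈ smooth (S := S), ∀ᶠ y : A in 𝓝 x, f y = g y := by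
  obtain ⟨U, hU, hx, n, q, hq, G, hG, h⟩ := hf x
  choose p hp hpq using hq
  refine ⟨_, DifferentialSpace.comp_mem n p hp G hG, ?_⟩
  filter_upwards [hU.mem_nhds hx] with y hy
  simp only [h y hy, hpq]

theorem eventually_nhds_coe {S : Type*} [TopologicalSpace S] {A : Set S} (hA : IsOpen A) {x : A} {p : S → Prop}
    (h : ∀ᶠ y : A in 𝓝 x, p y) : ∀ᶠ y in 𝓝 (x : S), p y := by
  rw [← hA.isOpenEmbedding_subtypeVal.map_nhds_eq x]
  exact h

theorem isSmoothMap_euclidean {l : ℕ} {φ : S → EuclideanSpace ℝ (Fin l)}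
    (h : ∀ j, (fun x => φ x j) ∈ smooth (S := S)) : IsSmoothMap φ := by
  intro f hf
  have hf' : ContDiff ℝ ∞ f := hf
  exact DifferentialSpace.comp_mem l (fun j x => φ x j) h (fun v => f (WithLp.toLp 2 v))
    (hf'.comp (PiLp.contDiff_toLp))

/-! ### Bump functions -/

theorem exists_bump {U : Set S} (hU : IsOpen U) {x : S} (hx : x ∈ U) :
    ∃ f ∈ smooth (S := S), f x ≠ 0 ∧ tsupport f ⊆ U := by
  have h := DifferentialSpace.subbasis (S := S)
  rw [h] at hU
  induction hU with
  | basic W hW =>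
    obtain ⟨f, hf, a, b, rfl⟩ := hW
    obtain ⟨χ, hχs, -, hχ, -, hχ1⟩ :=
      exists_contDiff_tsupport_subset (n := ⊤) (isOpen_Ioo.mem_nhds hx)
    refine ⟨fun y => χ (f y), comp_mem_one hf hχ, by simp [hχ1], ?_⟩
    exact (tsupport_comp_subset_preimage χ (continuous_of_mem hf)).trans (preimage_mono hχs)
  | univ => exact ⟨fun _ => 1, const_mem 1, one_ne_zero, subset_univ _⟩
  | inter V W _ _ hV hW =>
    obtain ⟨f, hf, hfx, hfs⟩ := hV hx.1
    obtain ⟨g, hg, hgx, hgs⟩ := hW hx.2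
    exact ⟨_, mul_mem hf hg, mul_ne_zero hfx hgx,
      subset_inter ((tsupport_mul_subset_left).trans hfs) ((tsupport_mul_subset_right).trans hgs)⟩
  | sUnion 𝒲 _ ih =>
    obtain ⟨W, hW, hxW⟩ := hx
    obtain ⟨f, hf, hfx, hfs⟩ := ih W hW hxW
    exact ⟨f, hf, hfx, hfs.trans (subset_sUnion_of_mem hW)⟩

/-- Smooth cut-off functions, locally finite and without common zero, subordinate to an open
cover. They exist although `S` need not be locally compact. -/
theorem exists_locallyFinite_bumps [SecondCountableTopology S] [Nonempty S] {U : S → Set S}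
    (hU : ∀ x, IsOpen (U x)) (hxU : ∀ x, x ∈ U x) :
    ∃ (p : ℕ → S) (g : ℕ → S → ℝ), (∀ n, g n ∈ smooth (S := S)) ∧
      (∀ n, tsupport (g n) ⊆ U (p n)) ∧ (∀ x, ∃ n, g n x ≠ 0) ∧
      ∀ x, ∃ N, ∀ᶠ y in 𝓝 x, ∀ n ≥ N, g n y = 0 := by
  have key : ∀ x, ∃ f ∈ smooth (S := S), 1 < f x ∧ tsupport f ⊆ U x := by
    intro x
    obtain ⟨f, hf, hfx, hfs⟩ := exists_bump (hU x) (hxU x)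
    refine ⟨_, mul_mem (const_mem (2 / f x)) hf, ?_, (tsupport_mul_subset_right).trans hfs⟩
    rw [div_mul_cancel₀ _ hfx]
    norm_num
  choose f hf hfx hfs using key
  obtain ⟨s, hsc, hs⟩ := TopologicalSpace.countable_cover_nhds
    (f := fun x => {y | 1 < f x y}) fun x =>
      (isOpen_lt continuous_const (continuous_of_mem (hf x))).mem_nhds (hfx x)
  have hsn : s.Nonempty := by
    obtain ⟨x⟩ := ‹Nonempty S›
    obtain ⟨y, hy, -⟩ := mem_iUnion₂.1 (hs.symm ▸ mem_univ x)
    exact ⟨y, hy⟩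
  obtain ⟨p, rfl⟩ := hsc.exists_eq_range hsn
  have hcov : ∀ x, ∃ n, 1 < f (p n) x := by
    intro x
    obtain ⟨_, ⟨n, rfl⟩, hy⟩ := mem_iUnion₂.1 (hs.symm ▸ mem_univ x)
    exact ⟨n, hy⟩
  -- The `n`-th function is multiplied by factors that vanish where an earlier one is `≥ 1`.
  let η : ℝ → ℝ := fun t => expNegInvGlue (1 - t)
  have hη : ContDiff ℝ ∞ η := expNegInvGlue.contDiff.comp (contDiff_const.sub contDiff_id)
  refine ⟨p, fun n x => f (p n) x * ∏ i ∈ Finset.range n, η (f (p i) x), fun n => ?_, fun n => ?_,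
    fun x => ?_, fun x => ?_⟩
  · exact mul_mem (hf _) (prod_range_mem (fun i => comp_mem_one (hf _) hη) n)
  · exact (tsupport_mul_subset_left).trans (hfs _)
  · classical
    have hex : ∃ n, 1 ≤ f (p n) x := (hcov x).imp fun _ h => h.le
    refine ⟨Nat.find hex, mul_ne_zero ?_ (Finset.prod_ne_zero_iff.2 fun i hi => ?_)⟩
    · have := Nat.find_spec hex
      positivity
    · have := Nat.find_min hex (Finset.mem_range.1 hi)
      exact (expNegInvGlue.pos_of_pos (by linarith)).ne'
  · obtain ⟨m, hm⟩ := hcov x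
    refine ⟨m + 1, ?_⟩
    filter_upwards [(isOpen_lt continuous_const (continuous_of_mem (hf (p m)))).mem_nhds hm]
      with y hy n hn
    have hy' : 1 < f (p m) y := hy
    rw [Finset.prod_eq_zero (Finset.mem_range.2 hn) (expNegInvGlue.zero_of_nonpos (by linarith)),
      mul_zero]

/-! ### Local coordinates -/

/-- The map `α` into a normed space is a system of smooth coordinates at `x` if near `x` every
smooth function is a smooth function of `α`. The values of `α` away from `x` are irrelevant, and
`α` itself is not required to be smooth. -/
def HasCoordinatesAt {F : Type*} [NormedAddCommGroup F] [NormedSpace ℝ F] (α : S → F) (x : S) :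
    Prop :=
  ∀ f ∈ smooth (S := S), ∃ G : F → ℝ, ContDiff ℝ ∞ G ∧ ∀ᶠ y in 𝓝 x, f y = G (α y)

theorem HasChartAt.exists_hasCoordinatesAt {x : S} {n : ℕ} (h : HasChartAt x n) :
    ∃ α : S → EuclideanSpace ℝ (Fin n), HasCoordinatesAt α x := by
  classical
  obtain ⟨U, hU, hx, V, φ, hφ, hφ'⟩ := h
  refine ⟨fun y => if hy : y ∈ U then φ ⟨y, hy⟩ else 0, fun f hf => ?_⟩
  obtain ⟨G, hG, hfG⟩ := exists_eventuallyEq_of_mem_subspace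
    (hφ' _ (isSmoothMap_val U f hf)) (φ ⟨x, hx⟩)
  refine ⟨G, hG, eventually_nhds_coe hU (x := ⟨x, hx⟩) ?_⟩
  filter_upwards [hφ.continuous.continuousAt.eventually hfG] with y hy
  simpa using hy

theorem exists_hasChartAt_le {N : ℕ} (hN : structuralDim S ≤ N) (x : S) :
    ∃ n ≤ N, HasChartAt x n := by
  have h : structuralDimAt x < (N + 1 : ℕ) :=
    ((le_iSup structuralDimAt x).trans hN).trans_lt (by exact_mod_cast Nat.lt_succ_self N)
  simp only [structuralDimAt, iInf_lt_iff] at h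
  obtain ⟨n, hn, hlt⟩ := h
  exact ⟨n, Nat.lt_succ_iff.1 (by exact_mod_cast hlt), hn⟩

/-- Near a point with coordinates in `F`, the map `∑ i < n, fᵢ cᵢ` has its values in the range of a
smooth map defined on `F`. -/
theorem HasCoordinatesAt.exists_dimH_image_le {F : Type*} [NormedAddCommGroup F] [NormedSpace ℝ F]
    [FiniteDimensional ℝ F] {α : S → F} {x : S} (hα : HasCoordinatesAt α x)
    {V : Type*} [NormedAddCommGroup V] [NormedSpace ℝ V] [FiniteDimensional ℝ V]
    {f : ℕ → S → ℝ} (hf : ∀ i, f i ∈ smooth (S := S)) (n : ℕ) (c : Fin n → V) :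
    ∃ W ∈ 𝓝 x, dimH ((fun y => ∑ i : Fin n, f i y • c i) '' W) ≤ Module.finrank ℝ F := by
  choose G hG hfG using fun i : Fin n => hα _ (hf i)
  refine ⟨_, eventually_all.2 hfG, ?_⟩
  have hs : ContDiff ℝ 1 fun v => ∑ i, G i v • c i :=
    ContDiff.sum fun i _ => ((hG i).of_le (by simp)).smul contDiff_const
  refine (dimH_mono ?_).trans hs.dimH_range_le
  rintro _ ⟨y, hy, rfl⟩
  exact ⟨α y, Finset.sum_congr rfl fun i _ => by rw [hy i]⟩

end Basic

end DifferentialSpace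

namespace SmoothVectorBundle

variable {E S : Type*} [TopologicalSpace E] [DifferentialSpace E]
    [TopologicalSpace S] [DifferentialSpace S] {k : ℕ}

/-! ### The total space of a vector bundle -/

theorem secondCountableTopology_total [SecondCountableTopology S] (B : SmoothVectorBundle E S k) :
    SecondCountableTopology E := by
  choose U hU hx ψ hψ _ using B.exists_coordinates
  have hπ := B.isSmoothMap_proj.continuous
  obtain ⟨s, hsc, hs⟩ := TopologicalSpace.countable_cover_nhds
    (f := U) fun x => (hU x).mem_nhds (hx x)
  have := hsc.to_subtype
  have hsec : ∀ x : s, SecondCountableTopology (B.proj ⁻¹' U x) := fun x =>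
    (Homeomorph.mk (ψ x) (hψ x).1.continuous
      (hψ x).2.continuous).symm.isInducing.secondCountableTopology
  refine TopologicalSpace.secondCountableTopology_of_countable_cover
    (U := fun x : s => B.proj ⁻¹' U x) (fun x => (hU x).preimage hπ) ?_
  rw [← preimage_iUnion, ← biUnion_eq_iUnion s (fun x _ => U x), hs, preimage_univ]

theorem exists_hasCoordinatesAt_total (B : SmoothVectorBundle E S k) {F : Type*}
    [NormedAddCommGroup F] [NormedSpace ℝ F] {e : E} {α : S → F}
    (hα : HasCoordinatesAt α (B.proj e)) :
    ∃ β : E → F × EuclideanSpace ℝ (Fin k), HasCoordinatesAt β e := by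
  classical
  obtain ⟨U, hU, hx, ψ, ⟨hψ, hψ'⟩, hψU, -⟩ := B.exists_coordinates (B.proj e)
  have hUE : IsOpen (B.proj ⁻¹' U) := hU.preimage B.isSmoothMap_proj.continuous
  refine ⟨fun d => if hd : B.proj d ∈ U then (α (B.proj d), (ψ.symm ⟨d, hd⟩).2) else 0,
    fun f hf => ?_⟩
  set p₀ : U × EuclideanSpace ℝ (Fin k) := ψ.symm ⟨e, hx⟩
  have hp₀ : (p₀.1 : S) = B.proj e := by
    rw [← hψU p₀, Equiv.apply_symm_apply]
  obtain ⟨W, hW, hpW, n, g, hg, G, hG, hfG⟩ := hψ _ (isSmoothMap_val _ f hf) p₀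
  have key : ∀ i, ∃ H : F × EuclideanSpace ℝ (Fin k) → ℝ, ContDiff ℝ ∞ H ∧
      ∀ᶠ p in 𝓝 p₀, g i p = H (α p.1, p.2) := by
    intro i
    rcases hg i with ⟨q, hq, hgq⟩ | ⟨q, hq, hgq⟩
    · obtain ⟨r, hr, hqr⟩ := exists_eventuallyEq_of_mem_subspace hq p₀.1
      obtain ⟨K, hK, hrK⟩ := hα r hr
      refine ⟨fun v => K v.1, hK.comp contDiff_fst, ?_⟩
      have hc : Tendsto (fun p : U × EuclideanSpace ℝ (Fin k) => (p.1 : S)) (𝓝 p₀)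
          (𝓝 (B.proj e)) := by
        rw [← hp₀]
        exact (continuous_subtype_val.comp continuous_fst).continuousAt
      filter_upwards [continuous_fst.continuousAt.eventually hqr, hc.eventually hrK]
        with p h₁ h₂
      simp only [hgq]
      rw [h₁, h₂]
    · have hq' : ContDiff ℝ ∞ q := hq
      exact ⟨fun v => q v.2, hq'.comp contDiff_snd, Eventually.of_forall fun p => by simp [hgq]⟩
  choose H hH hgH using key
  refine ⟨fun v => G fun i => H i v, hG.comp (contDiff_pi.2 hH),
    eventually_nhds_coe hUE (x := ⟨e, hx⟩) ?_⟩
  have hev : ∀ᶠ p in 𝓝 p₀, f (ψ p) = G fun i => H i (α p.1, p.2) := by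
    filter_upwards [hW.mem_nhds hpW, eventually_all.2 hgH] with p h₁ h₂
    rw [← funext h₂]
    exact hfG p h₁
  filter_upwards [hψ'.continuous.continuousAt.eventually hev] with d hd
  have hd₁ : ((ψ.symm d).1 : S) = B.proj d := by
    rw [← hψU, Equiv.apply_symm_apply]
  have hdU : B.proj d ∈ U := d.2
  simpa [hd₁, hdU] using hd

/-- A linear combination of smooth functions on the total space with coefficients in a vector
space has a range of dimension at most `dim S + k`. -/
theorem dimH_range_sum_smul_le [SecondCountableTopology S] (B : SmoothVectorBundle E S k) {N : ℕ}
    (hN : structuralDim S ≤ N)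
    {V : Type*} [NormedAddCommGroup V] [NormedSpace ℝ V] [FiniteDimensional ℝ V]
    {f : ℕ → E → ℝ} (hf : ∀ i, f i ∈ smooth (S := E)) (n : ℕ) (c : Fin n → V) :
    dimH (range fun e => ∑ i : Fin n, f i e • c i) ≤ (N + k : ℕ) := by
  have := B.secondCountableTopology_total
  have key : ∀ e, ∃ W ∈ 𝓝 e,
      dimH ((fun e => ∑ i : Fin n, f i e • c i) '' W) ≤ (N + k : ℕ) := by
    intro e
    obtain ⟨m, hm, hchart⟩ := exists_hasChartAt_le hN (B.proj e)
    obtain ⟨α, hα⟩ := hchart.exists_hasCoordinatesAt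
    obtain ⟨β, hβ⟩ := B.exists_hasCoordinatesAt_total hα
    obtain ⟨W, hW, hle⟩ := hβ.exists_dimH_image_le hf n c
    refine ⟨W, hW, hle.trans ?_⟩
    simpa using hm
  choose W hW hle using key
  obtain ⟨s, hsc, hs⟩ := TopologicalSpace.countable_cover_nhds hW
  rw [← image_univ, ← hs, image_iUnion₂, dimH_bUnion hsc]
  exact iSup₂_le fun e _ => hle e

/-! ### Fibrewise linear functions -/

/-- A function on the total space is fibrewise linear if its restriction to each fibre is linear. -/
def IsFibrewiseLinear {V : Type*} [AddCommGroup V] [Module ℝ V] (B : SmoothVectorBundle E S k)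
    (f : E → V) : Prop :=
  ∀ x, IsLinearMap ℝ fun e : B.Fibre x => f e

/-- The coordinates of the fibre over a trivializing set, cut off by a smooth function `g` with
support in that set. They separate the points of the fibres over the points with `g x ≠ 0`. -/
theorem exists_cutoff_coordinates (B : SmoothVectorBundle E S k) (x₀ : S) :
    ∃ U : Set S, IsOpen U ∧ x₀ ∈ U ∧ ∀ g ∈ smooth (S := S), tsupport g ⊆ U →
      ∃ f : Fin k → E → ℝ, (∀ j, f j ∈ smooth (S := E)) ∧ (∀ j, B.IsFibrewiseLinear (f j)) ∧
        (∀ j e, g (B.proj e) = 0 → f j e = 0) ∧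
        ∀ x, g x ≠ 0 → ∀ e : B.Fibre x, (∀ j, f j e = 0) → e = 0 := by
  classical
  obtain ⟨U, hU, hx, ψ, ⟨-, hψ'⟩, -, hL⟩ := B.exists_coordinates x₀
  have hπ := B.isSmoothMap_proj.continuous
  have hUE : IsOpen (B.proj ⁻¹' U) := hU.preimage hπ
  refine ⟨U, hU, hx, fun g hg hgU => ?_⟩
  have hg0 : ∀ x, x ∉ U → g x = 0 := fun x hx => by
    by_contra h
    exact hx (hgU (subset_tsupport g h))
  let y : E → EuclideanSpace ℝ (Fin k) := fun e =>
    if he : B.proj e ∈ U then (ψ.symm ⟨e, he⟩).2 else 0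
  have hyL : ∀ x ∈ U, ∃ L : B.Fibre x ≃ₗ[ℝ] EuclideanSpace ℝ (Fin k),
      ∀ e : B.Fibre x, y e = L e := by
    intro x hxU
    obtain ⟨L, hL⟩ := hL ⟨x, hxU⟩
    refine ⟨L, fun e => ?_⟩
    have he : B.proj e ∈ U := by
      rw [show B.proj e = x from e.2]
      exact hxU
    have h : ψ.symm ⟨e, he⟩ = (⟨x, hxU⟩, L e) := by
      rw [Equiv.symm_apply_eq]
      exact Subtype.ext (hL e).symm
    simp only [y, dif_pos he, h]
  refine ⟨fun j e => g (B.proj e) * y e j, fun j => ?_, fun j x => ?_, fun j e he => ?_,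
    fun x hgx e he => ?_⟩
  · refine mem_of_eventuallyEq fun e => ?_
    by_cases he : B.proj e ∈ U
    · have hj : (fun v : EuclideanSpace ℝ (Fin k) => v j) ∈
          smooth (S := EuclideanSpace ℝ (Fin k)) :=
        show ContDiff ℝ ∞ fun v : EuclideanSpace ℝ (Fin k) => v j by fun_prop
      obtain ⟨r, hr, hyr⟩ := exists_eventuallyEq_of_mem_subspace
        (hψ' _ (isSmoothMap_snd U _ _ hj)) ⟨e, he⟩
      refine ⟨_, mul_mem (B.isSmoothMap_proj g hg) hr,
        eventually_nhds_coe hUE (x := ⟨e, he⟩) ?_⟩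
      filter_upwards [hyr] with d hd
      have hdU : B.proj d ∈ U := d.2
      simp only [Function.comp_apply] at hd
      simp only [y, dif_pos hdU, ← hd, Function.comp_apply]
    · refine ⟨fun _ => 0, const_mem 0, ?_⟩
      have h : B.proj e ∈ (tsupport g)ᶜ := fun h => he (hgU h)
      filter_upwards [hπ.continuousAt.preimage_mem_nhds
        ((isClosed_tsupport g).isOpen_compl.mem_nhds h)] with d hd
      rw [image_eq_zero_of_notMem_tsupport hd, zero_mul]
  · by_cases hxU : x ∈ U
    · obtain ⟨L, hL⟩ := hyL x hxU
      have h : ∀ e : B.Fibre x, B.proj e = x := fun e => e.2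
      constructor
      · intro e d
        simp only [hL, h, map_add, PiLp.add_apply, mul_add]
      · intro t e
        simp only [hL, h, map_smul, PiLp.smul_apply, smul_eq_mul]
        ring
    · have h : ∀ e : B.Fibre x, g (B.proj e) = 0 := fun e => by
        rw [show B.proj e = x from e.2, hg0 x hxU]
      constructor <;> intros <;> simp [h]
  · simp only [he, zero_mul]
  · have hxU : x ∈ U := by
      by_contra h
      exact hgx (hg0 x h)
    obtain ⟨L, hL⟩ := hyL x hxU
    have h : B.proj e = x := e.2
    refine L.map_eq_zero_iff.1 (PiLp.ext fun j => ?_)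
    have : g (B.proj e) * y e j = 0 := he j
    rw [h, hL] at this
    simpa [hgx] using this

theorem exists_fibrewiseLinear_sequence [SecondCountableTopology S] [Nonempty S]
    (B : SmoothVectorBundle E S k) :
    ∃ f : ℕ → E → ℝ, (∀ m, f m ∈ smooth (S := E)) ∧ (∀ m, B.IsFibrewiseLinear (f m)) ∧
      (∀ e, ∃ M, ∀ᶠ d in 𝓝 e, ∀ m ≥ M, f m d = 0) ∧
      ∀ x, ∀ e : B.Fibre x, (∀ m, f m e = 0) → e = 0 := by
  choose U hU hxU hf using B.exists_cutoff_coordinates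
  obtain ⟨p, g, hg, hgU, hg0, hfin⟩ := exists_locallyFinite_bumps hU hxU
  choose f hfs hfl hf0 hfi using fun n => hf (p n) (g n) (hg n) (hgU n)
  have hinj : Function.Injective (Encodable.encode : ℕ × Fin k → ℕ) := Encodable.encode_injective
  let F : ℕ → E → ℝ := Function.extend Encodable.encode (fun a : ℕ × Fin k => f a.1 a.2) 0
  have hF : ∀ a : ℕ × Fin k, F (Encodable.encode a) = f a.1 a.2 := fun a => hinj.extend_apply _ _ a
  have hF0 : ∀ m, (¬ ∃ a : ℕ × Fin k, Encodable.encode a = m) → F m = 0 := fun m hm =>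
    Function.extend_apply' _ _ _ hm
  refine ⟨F, fun m => ?_, fun m => ?_, fun e => ?_, fun x e he => ?_⟩
  · by_cases hm : ∃ a : ℕ × Fin k, Encodable.encode a = m
    · obtain ⟨a, rfl⟩ := hm
      rw [hF]
      exact hfs _ _
    · rw [hF0 m hm]
      exact const_mem 0
  · by_cases hm : ∃ a : ℕ × Fin k, Encodable.encode a = m
    · obtain ⟨a, rfl⟩ := hm
      rw [hF]
      exact hfl _ _
    · rw [hF0 m hm]
      exact fun x => (0 : B.Fibre x →ₗ[ℝ] ℝ).isLinear
  · obtain ⟨N, hN⟩ := hfin (B.proj e)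
    let t : Finset (ℕ × Fin k) := Finset.range N ×ˢ Finset.univ
    refine ⟨t.sup Encodable.encode + 1, ?_⟩
    filter_upwards [B.isSmoothMap_proj.continuous.continuousAt.eventually hN] with d hd m hm
    by_cases hm' : ∃ a : ℕ × Fin k, Encodable.encode a = m
    · obtain ⟨a, rfl⟩ := hm'
      rw [hF]
      refine hf0 _ _ _ (hd _ ?_)
      by_contra! hlt
      have := Finset.le_sup (f := Encodable.encode) (show a ∈ t by simpa [t] using hlt)
      omega
    · rw [hF0 m hm', Pi.zero_apply]
  · obtain ⟨n, hn⟩ := hg0 x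
    exact hfi n x hn e fun j => by rw [← he (Encodable.encode (n, j)), hF]

/-! ### General position -/

/-- A sequence chosen by recursion, each term outside a set that depends on the earlier terms. -/
noncomputable def avoidingSequence {V : Type*} {P : ∀ n, (Fin n → V) → Set V}
    (h : ∀ n c, ∃ v, v ∉ P n c) (n : ℕ) : V :=
  (h n fun i => avoidingSequence h i).choose

theorem avoidingSequence_notMem {V : Type*} {P : ∀ n, (Fin n → V) → Set V}
    (h : ∀ n c, ∃ v, v ∉ P n c) (n : ℕ) :
    avoidingSequence h n ∉ P n fun i => avoidingSequence h i := by
  conv in (avoidingSequence h n) => rw [avoidingSequence]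
  exact (h n fun i => avoidingSequence h i).choose_spec

/-- If each `cₙ` lies outside the range of `∑ i < n, fᵢ cᵢ`, then a vector of a fibre is killed by
a finite sum `∑ fᵢ cᵢ` only if it is killed by all the `fᵢ`. -/
theorem eq_zero_of_sum_smul_eq_zero (B : SmoothVectorBundle E S k) {V : Type*} [AddCommGroup V]
    [Module ℝ V] {f : ℕ → E → ℝ} (hf : ∀ m, B.IsFibrewiseLinear (f m)) {c : ℕ → V}
    (hc : ∀ n, c n ∉ range fun e => ∑ i : Fin n, f i e • c i) {x : S} (e : B.Fibre x) (M : ℕ)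
    (h : ∑ i ∈ Finset.range M, f i e • c i = 0) : ∀ m < M, f m e = 0 := by
  induction M with
  | zero => intro m hm; omega
  | succ n ih =>
    rw [Finset.sum_range_succ] at h
    have hn : f n e = 0 := by
      by_contra hne
      -- After rescaling `e` such that `fₙ e = -1`, the relation reads `∑ i < n, fᵢ e • cᵢ = cₙ`.
      refine hc n ⟨((-(f n e)⁻¹) • e : B.Fibre x), ?_⟩
      have hs : ∀ i : Fin n, f i ((-(f n e)⁻¹) • e : B.Fibre x) = -(f n e)⁻¹ * f i e :=
        fun i => (hf i x).map_smul _ e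
      simp only [hs, mul_smul, ← Finset.smul_sum]
      rw [Finset.sum_range] at h
      rw [eq_neg_of_add_eq_zero_left h, smul_neg, neg_smul, neg_neg, smul_smul,
        inv_mul_cancel₀ hne, one_smul]
    rw [hn, zero_smul, add_zero] at h
    intro m hm
    rcases Nat.lt_succ_iff_lt_or_eq.1 hm with hlt | rfl
    · exact ih h m hlt
    · exact hn

end SmoothVectorBundle

open SmoothVectorBundle

/-- Every smooth vector bundle over a connected, second countable subcartesian space of finite
structural dimension admits a smooth injective bundle map into a trivial bundle `S × ℝˡ`. -/
theorem proposition6p2 {E S : Type*}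
    [TopologicalSpace S] [DifferentialSpace S] [SubcartesianSpace S]
    [SecondCountableTopology S] [ConnectedSpace S] (hS : structuralDim S < ⊤)
    [TopologicalSpace E] [DifferentialSpace E] [SubcartesianSpace E]
    (k : ℕ) (B : SmoothVectorBundle E S k) :
    ∃ (l : ℕ) (φ : E → S × EuclideanSpace ℝ (Fin l)),
      B.IsSmoothBundleMap (SmoothVectorBundle.trivialBundle S l) φ ∧
        Function.Injective φ := by
  obtain ⟨N, hN⟩ := WithTop.ne_top_iff_exists.1 hS.ne
  obtain ⟨f, hfs, hfl, hfin, hf0⟩ := B.exists_fibrewiseLinear_sequence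
  let V := EuclideanSpace ℝ (Fin (N + k + 1))
  have hex : ∀ (n : ℕ) (c : Fin n → V), ∃ v, v ∉ range fun e => ∑ i : Fin n, f i e • c i := by
    intro n c
    have hlt : dimH (range fun e => ∑ i : Fin n, f i e • c i) < Module.finrank ℝ V := by
      refine (B.dimH_range_sum_smul_le (N := N) hN.ge hfs n c).trans_lt ?_
      rw [finrank_euclideanSpace_fin]
      exact_mod_cast Nat.lt_succ_self _
    exact (dense_compl_of_dimH_lt_finrank hlt).nonempty
  let c : ℕ → V := avoidingSequence hex
  have hc : ∀ n, c n ∉ range fun e => ∑ i : Fin n, f i e • c i := avoidingSequence_notMem hex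
  choose M hM using hfin
  let Φ : E → V := fun e => ∑ i ∈ Finset.range (M e), f i e • c i
  -- The bound `M e` in the definition of `Φ e` may be replaced by any larger one.
  have hΦ' : ∀ e n, (∀ m ≥ n, f m e = 0) → Φ e = ∑ i ∈ Finset.range n, f i e • c i := by
    intro e n hn
    have hMe := (hM e).self_of_nhds
    refine (Finset.eventually_constant_sum (u := fun i => f i e • c i) (N := M e)
      (fun m hm => by simp [hMe m hm]) (le_max_left (M e) n)).symm.trans
      (Finset.eventually_constant_sum (u := fun i => f i e • c i) (N := n)
      (fun m hm => by simp [hn m hm]) (le_max_right (M e) n))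
  have hΦs : IsSmoothMap Φ := by
    refine isSmoothMap_euclidean fun j => mem_of_eventuallyEq fun e => ?_
    refine ⟨_, sum_range_mul_mem hfs (fun i => c i j) (M e), ?_⟩
    filter_upwards [hM e] with d hd
    rw [hΦ' d _ hd]
    simp [V]
  have hΦl : B.IsFibrewiseLinear Φ := by
    intro x
    constructor
    · intro e d
      have h : ∀ a : B.Fibre x, (∀ m ≥ max (M e) (max (M d) (M (e + d : B.Fibre x))), f m a = 0) →
        Φ a = _ := fun a => hΦ' a _
      rw [h e, h d, h (e + d), ← Finset.sum_add_distrib]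
      · refine Finset.sum_congr rfl fun i _ => ?_
        rw [(hfl i x).map_add, add_smul]
      · exact fun m hm => (hM _).self_of_nhds m (by omega)
      · exact fun m hm => (hM _).self_of_nhds m (by omega)
      · exact fun m hm => (hM _).self_of_nhds m (by omega)
    · intro t e
      rw [hΦ' (t • e : B.Fibre x) (M e) fun m hm => by
        rw [(hfl m x).map_smul, (hM e).self_of_nhds m hm, smul_zero]]
      simp only [Φ, Finset.smul_sum]
      refine Finset.sum_congr rfl fun i _ => ?_
      rw [(hfl i x).map_smul, smul_assoc]
  have hΦ0 : ∀ x, ∀ e : B.Fibre x, Φ e = 0 → e = 0 := by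
    intro x e he
    refine hf0 x e fun m => ?_
    by_cases hm : m < M e
    · exact B.eq_zero_of_sum_smul_eq_zero hfl hc e _ he m hm
    · exact (hM e).self_of_nhds m (not_lt.1 hm)
  refine ⟨N + k + 1, fun e => (B.proj e, Φ e),
    ⟨isSmoothMap_prod_mk B.isSmoothMap_proj hΦs, fun x => ?_⟩, fun e d hed => ?_⟩
  · refine ⟨{ toFun := fun e => (fstFibreEquiv V x).symm (Φ e)
              map_add' := fun e d => congrArg (fstFibreEquiv V x).symm ((hΦl x).map_add e d)
              map_smul' := fun t e => congrArg (fstFibreEquiv V x).symm ((hΦl x).map_smul t e) },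
      fun e => Prod.ext e.2 rfl⟩
  · obtain ⟨h₁, h₂⟩ := Prod.ext_iff.1 hed
    have h := hΦ0 (B.proj d) ((⟨e, h₁⟩ : B.Fibre (B.proj d)) - ⟨d, rfl⟩)
      (((hΦl _).map_sub _ _).trans (sub_eq_zero.2 h₂))
    exact congrArg Subtype.val (sub_eq_zero.1 h)
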